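/- A qubit channel is a completely positive trace-preserving linear map $\mathcal E$ on $M_2(\mathbb C)$. Its average fidelity is $\overline F(\mathcal E)=\int d\phi\,\langle\phi|\mathcal E(|\phi\rangle\langle\phi|)|\phi\rangle$, where $d\phi$ is the unitarily invariant probability measure on unit vectors of $\mathbb C^2$, and its affine (Bloch) matrix is the real $3\times3$ matrix $M_{\alpha\beta}=\frac12\mathrm{Tr}(\sigma_\alpha\mathcal E(\sigma_\beta))$, with $\sigma_1,\sigma_2,\sigma_3$ the Pauli matrices. A channel $\mathcal N$ is a (left) quasi-inverse of $\mathcal E$ if $\overline F(\mathcal N\circ\mathcal E)\ge\overline F(\mathcal E)$ and $\overline F(\mathcal N\circ\mathcal E)\ge\overline F(\mathcal N'\circ\mathcal E)$ for every channel $\mathcal N'$; it is a right quasi-inverse if the same holds with $\mathcal E\circ\mathcal N$ and $\mathcal E\circ\mathcal N'$. Let $\mathcal E$ be a qubit channel with affine matrix $M$. (a) For every qubit channel $\mathcal N$ with affine matrix $N$, $\overline F(\mathcal N\circ\mathcal E)=\overline F(\mathcal E\circ\mathcal N)=\frac12\bigl(1+\frac13\mathrm{Tr}(NM)\bigr)$.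 Hence $\mathcal N$ is a left quasi-inverse of $\mathcal E$ if and only if it is a right quasi-inverse. (b) $\mathcal E$ has a finite Kraus representation $\mathcal E(\rho)=\sum_iK_i\rho K_i^\dagger$ with $K_i=a_i+\boldsymbol b_i\cdot\boldsymbol\sigma$, $a_i\in\mathbb C$, $\boldsymbol b_i\in\mathbb C^3$. For every such representation put $$B_{\alpha\beta}=\tfrac12\sum_i\bigl(b_{i\alpha}b_{i\beta}^*+b_{i\alpha}^*b_{i\beta}\bigr),\quad \boldsymbol v=i\sum_i(a_i^*\boldsymbol b_i-a_i\boldsymbol b_i^*),\quad \widehat B=B-I+\mathrm{Tr}(B)\,I,\quad Q=\frac12\begin{pmatrix}0&\boldsymbol v^T\\ \boldsymbol v&2\widehat B\end{pmatrix},$$ a real symmetric $4\times4$ matrix, and let $\lambda_{\max}$ be its largest eigenvalue. For $(x_0,\boldsymbol x)\in\mathbb R\times\mathbb R^3$ with $x_0^2+\boldsymbol x\cdot\boldsymbol x=1$ put $V=x_0+i\,\boldsymbol x\cdot\boldsymbol\sigma$ and $\mathcal V(\rho)=V\rho V^\dagger$. Then: 1. for every such unit vector, $\overline F(\mathcal V\circ\mathcal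 E)-\overline F(\mathcal E)=\overline F(\mathcal E\circ\mathcal V)-\overline F(\mathcal E)=\frac23\,(x_0,\boldsymbol x^T)\,Q\,(x_0,\boldsymbol x^T)^T$; 2. $\max_{\mathcal N}\bigl(\overline F(\mathcal N\circ\mathcal E)-\overline F(\mathcal E)\bigr)=\max_{\mathcal N}\bigl(\overline F(\mathcal E\circ\mathcal N)-\overline F(\mathcal E)\bigr)=\frac23\max(\lambda_{\max},0)$, where both maxima run over all qubit channels $\mathcal N$ and are attained; 3. if the unit vector $(x_0,\boldsymbol x)$ is an eigenvector of $Q$ for $\lambda_{\max}$, then $V$ is unitary, $\mathcal V$ is both a left and a right quasi-inverse of $\mathcal E$, and $V=e^{i\phi\,\boldsymbol n\cdot\boldsymbol\sigma}$ for some real $\phi$ and unit vector $\boldsymbol n\in\mathbb R^3$ with $x_0=\cos\phi$, $\boldsymbol x=\sin\phi\,\boldsymbol n$. -/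

import Mathlib

open MeasureTheory Matrix
open scoped ComplexConjugate

noncomputable section

/-! ### Qubit channels -/

/-- Linear maps on the operators of a qubit. -/
abbrev QubitMap : Type := Matrix (Fin 2) (Fin 2) ℂ →ₗ[ℂ] Matrix (Fin 2) (Fin 2) ℂ

open scoped Matrix.Norms.L2Operator MatrixOrder ComplexOrder CStarAlgebra in
/-- Complete positivity of a linear map on `M₂(ℂ)`, where `M₂(ℂ)` is regarded as a C⋆-algebra
(operator norm, and the order in which `0 ≤ A` means that `A` is positive semidefinite). -/
def IsCompletelyPositive (E : QubitMap) : Prop :=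
  ∃ Φ : Matrix (Fin 2) (Fin 2) ℂ →CP Matrix (Fin 2) (Fin 2) ℂ, Φ.toLinearMap = E

/-- A qubit channel: a completely positive, trace-preserving linear map on `M₂(ℂ)`. -/
def IsQuantumChannel (E : QubitMap) : Prop :=
  IsCompletelyPositive E ∧ ∀ ρ, (E ρ).trace = ρ.trace

/-! ### Average input-output fidelity -/

/-- The normalized state vectors of a qubit. -/
abbrev QubitState : Type := Metric.sphere (0 : EuclideanSpace ℂ (Fin 2)) 1

/-- The uniform measure on the unit sphere of `ℂ²`, normalized to total mass one. -/
def stateMeasure : Measure QubitState :=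
  ((volume : Measure (EuclideanSpace ℂ (Fin 2))).toSphere Set.univ)⁻¹ •
    (volume : Measure (EuclideanSpace ℂ (Fin 2))).toSphere

instance stateMeasure_isProbabilityMeasure : IsProbabilityMeasure stateMeasure := by
  constructor
  rw [stateMeasure, Measure.smul_apply, smul_eq_mul]
  refine ENNReal.inv_mul_cancel ?_ (measure_ne_top _ _)
  rw [Ne, Measure.measure_univ_eq_zero]
  exact Measure.toSphere_ne_zero _

/-- The action of a unitary operator of `ℂ²` on the normalized state vectors. -/
def unitaryAct (u : EuclideanSpace ℂ (Fin 2) ≃ₗᵢ[ℂ] EuclideanSpace ℂ (Fin 2))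
    (ψ : QubitState) : QubitState :=
  ⟨u ψ.1, by simp⟩

theorem measurable_unitaryAct
    (u : EuclideanSpace ℂ (Fin 2) ≃ₗᵢ[ℂ] EuclideanSpace ℂ (Fin 2)) :
    Measurable (unitaryAct u) :=
  ((u.continuous.comp continuous_subtype_val).subtype_mk _).measurable

open scoped Pointwise in
/-- The measure on state vectors is unitarily invariant. -/
theorem stateMeasure_map_unitaryAct
    (u : EuclideanSpace ℂ (Fin 2) ≃ₗᵢ[ℂ] EuclideanSpace ℂ (Fin 2)) :
    stateMeasure.map (unitaryAct u) = stateMeasure := by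
  have key : (volume : Measure (EuclideanSpace ℂ (Fin 2))).toSphere.map (unitaryAct u) =
      (volume : Measure (EuclideanSpace ℂ (Fin 2))).toSphere := by
    ext s hs
    rw [Measure.map_apply (measurable_unitaryAct u) hs,
      Measure.toSphere_apply' _ (measurable_unitaryAct u hs), Measure.toSphere_apply' _ hs]
    congr 1
    let w : EuclideanSpace ℂ (Fin 2) ≃ₗᵢ[ℝ] EuclideanSpace ℂ (Fin 2) :=
      { u.toLinearEquiv.restrictScalars ℝ with norm_map' := u.norm_map }
    have hw : ∀ x, w x = u x := fun _ => rfl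
    have hmp : MeasurePreserving w := w.measurePreserving
    have hpre : (w ⁻¹' (Set.Ioo (0 : ℝ) 1 • ((↑) '' s : Set (EuclideanSpace ℂ (Fin 2))))) =
        Set.Ioo (0 : ℝ) 1 • ((↑) '' (unitaryAct u ⁻¹' s) : Set (EuclideanSpace ℂ (Fin 2))) := by
      ext x
      simp only [Set.mem_preimage, Set.mem_smul, Set.mem_image]
      constructor
      · rintro ⟨r, hr, _, ⟨y, hy, rfl⟩, h⟩
        refine ⟨r, hr, u.symm y.1, ⟨⟨u.symm y.1, by simp⟩, ?_, rfl⟩, ?_⟩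
        · simpa [unitaryAct] using hy
        · apply w.injective
          rw [map_smul, hw, u.apply_symm_apply, h]
      · rintro ⟨r, hr, _, ⟨y, hy, rfl⟩, rfl⟩
        exact ⟨r, hr, u y.1, ⟨unitaryAct u y, hy, rfl⟩, by rw [map_smul, hw]⟩
    rw [← hpre]
    exact hmp.measure_preimage_emb w.toHomeomorph.measurableEmbedding _
  rw [stateMeasure, Measure.map_smul, key]

/-- The average fidelity `∫ ⟨φ| E(|φ⟩⟨φ|) |φ⟩ dφ`. For a channel the integrand is real, so taking
its real part loses nothing. -/
def avgFidelity (E : QubitMap) : ℝ :=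
  ∫ φ : QubitState,
    (star φ.1.ofLp ⬝ᵥ (E (vecMulVec φ.1.ofLp (star φ.1.ofLp)) *ᵥ φ.1.ofLp)).re ∂stateMeasure

/-! ### Quasi-inverses -/

/-- `N` is a (left) quasi-inverse of `E`. -/
def IsLeftQuasiInverse (E N : QubitMap) : Prop :=
  IsQuantumChannel N ∧ avgFidelity E ≤ avgFidelity (N ∘ₗ E) ∧
    ∀ N' : QubitMap, IsQuantumChannel N' → avgFidelity (N' ∘ₗ E) ≤ avgFidelity (N ∘ₗ E)

/-- `N` is a right quasi-inverse of `E`. -/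
def IsRightQuasiInverse (E N : QubitMap) : Prop :=
  IsQuantumChannel N ∧ avgFidelity E ≤ avgFidelity (E ∘ₗ N) ∧
    ∀ N' : QubitMap, IsQuantumChannel N' → avgFidelity (E ∘ₗ N') ≤ avgFidelity (E ∘ₗ N)

/-! ### Pauli matrices, affine matrix, Kraus form -/

/-- The Pauli matrices. -/
def pauli : Fin 3 → Matrix (Fin 2) (Fin 2) ℂ :=
  ![!![0, 1; 1, 0], !![0, -Complex.I; Complex.I, 0], !![1, 0; 0, -1]]

/-- `c · σ`. -/
def dotPauli (c : Fin 3 → ℂ) : Matrix (Fin 2) (Fin 2) ℂ := ∑ α, c α • pauli α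

/-- The matrix `M` of the affine map `r ↦ M r + t` induced on the Bloch ball,
`M_{αβ} = ½ Tr (σ_α E(σ_β))` (a real number whenever `E` is a channel). -/
def blochMatrix (E : QubitMap) : Matrix (Fin 3) (Fin 3) ℝ :=
  Matrix.of fun α β => ((1 / 2 : ℂ) * (pauli α * E (pauli β)).trace).re

/-- The conjugation `ρ ↦ K ρ K†`. -/
def conjMap (K : Matrix (Fin 2) (Fin 2) ℂ) : QubitMap :=
  LinearMap.mulLeft ℂ K ∘ₗ LinearMap.mulRight ℂ Kᴴ

theorem conjMap_apply (K ρ : Matrix (Fin 2) (Fin 2) ℂ) : conjMap K ρ = K * ρ * Kᴴ := by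
  simp [conjMap, mul_assoc]

/-- The map `ρ ↦ ∑ᵢ Kᵢ ρ Kᵢ†` with Kraus operators `Kᵢ = aᵢ + bᵢ · σ`. -/
def krausMap {r : ℕ} (a : Fin r → ℂ) (b : Fin r → Fin 3 → ℂ) : QubitMap :=
  ∑ i, conjMap (a i • (1 : Matrix (Fin 2) (Fin 2) ℂ) + dotPauli (b i))

/-! ### The matrix `Q` -/

/-- `B_{αβ} = ½ ∑ᵢ (b_{iα} b_{iβ}* + b_{iα}* b_{iβ})`; see `krausB_coe` for its being real. -/
def krausB {r : ℕ} (b : Fin r → Fin 3 → ℂ) : Matrix (Fin 3) (Fin 3) ℝ :=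
  Matrix.of fun α β =>
    ((1 / 2 : ℂ) * ∑ i, (b i α * conj (b i β) + conj (b i α) * b i β)).re

theorem krausB_coe {r : ℕ} (b : Fin r → Fin 3 → ℂ) (α β : Fin 3) :
    (krausB b α β : ℂ) =
      (1 / 2 : ℂ) * ∑ i, (b i α * conj (b i β) + conj (b i α) * b i β) := by
  simp only [krausB, Matrix.of_apply]
  rw [← Complex.conj_eq_iff_re]
  simp only [one_div, map_mul, map_inv₀, map_ofNat, map_sum, map_add, Complex.conj_conj]
  congr 1
  exact Finset.sum_congr rfl fun i _ => add_comm _ _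

/-- `v = i ∑ᵢ (aᵢ* bᵢ - aᵢ bᵢ*)`; see `krausV_coe` for its being real. -/
def krausV {r : ℕ} (a : Fin r → ℂ) (b : Fin r → Fin 3 → ℂ) : Fin 3 → ℝ :=
  fun α => (Complex.I * ∑ i, (conj (a i) * b i α - a i * conj (b i α))).re

theorem krausV_coe {r : ℕ} (a : Fin r → ℂ) (b : Fin r → Fin 3 → ℂ) (α : Fin 3) :
    (krausV a b α : ℂ) = Complex.I * ∑ i, (conj (a i) * b i α - a i * conj (b i α)) := by
  simp only [krausV]
  rw [← Complex.conj_eq_iff_re]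
  simp only [map_mul, Complex.conj_I, map_sum, map_sub, Complex.conj_conj, neg_mul, ← mul_neg,
    ← Finset.sum_neg_distrib, neg_sub]

/-- `B̂ = B - I + Tr(B) I`. -/
def krausBhat {r : ℕ} (b : Fin r → Fin 3 → ℂ) : Matrix (Fin 3) (Fin 3) ℝ :=
  krausB b - 1 + (krausB b).trace • (1 : Matrix (Fin 3) (Fin 3) ℝ)

/-- The real symmetric `4 × 4` matrix `Q = ½ [[0, vᵀ], [v, 2 B̂]]`. -/
def krausQ {r : ℕ} (a : Fin r → ℂ) (b : Fin r → Fin 3 → ℂ) :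
    Matrix (Unit ⊕ Fin 3) (Unit ⊕ Fin 3) ℝ :=
  (1 / 2 : ℝ) • Matrix.fromBlocks 0 (replicateRow Unit (krausV a b))
    (replicateCol Unit (krausV a b)) ((2 : ℝ) • krausBhat b)

/-- The column vector `(x₀, x)ᵀ` of `ℝ⁴`. -/
def fourVec (x₀ : ℝ) (x : Fin 3 → ℝ) : Unit ⊕ Fin 3 → ℝ := Sum.elim (fun _ => x₀) x

/-- `V = x₀ + i x · σ`. -/
def pauliUnitary (x₀ : ℝ) (x : Fin 3 → ℝ) : Matrix (Fin 2) (Fin 2) ℂ :=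
  (x₀ : ℂ) • (1 : Matrix (Fin 2) (Fin 2) ℂ) + Complex.I • dotPauli fun α => (x α : ℂ)

end

open MeasureTheory Matrix
open scoped ComplexConjugate

noncomputable section

/-! Unitary invariance forces the Bloch vector of a random pure state to have mean zero and second
moments δ/3, so the average fidelity of a trace-preserving map is affine in the trace of its Bloch
matrix (`avgFidelity_eq`). Bloch matrices multiply under composition (`blochMatrix_comp`), and
cyclicity of the trace makes left and right composition equivalent.

It remains to maximize Tr(NM) over channels. For conjugation by x₀ + i x·σ, this trace is 4 times
the quadratic form of Q plus (x₀² + |x|²) Tr M (`trace_blochMatrix_pauliUnitary_mul`). A general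
Kraus operator splits as V₁ + iV₂ with both Vₖ of that form, and the Bloch matrix ignores the cross
terms (`blochMatrix_conjMap_eq_add`). Trace preservation gives the pieces total weight 1, so no
channel gains more than the maximum of the form on the unit sphere (`trace_blochMatrix_mul_le`).
That maximum is the largest eigenvalue, attained at a unit eigenvector, hence by a unitary channel.
-/

/-! ### Choi factorization and Kraus representations -/

theorem NonUnitalCStarAlgebra.nonneg_iff_exists_star_mul_self {A : Type*}
    [NonUnitalCStarAlgebra A] [PartialOrder A] [StarOrderedRing A] {a : A} :
    0 ≤ a ↔ ∃ b, a = star b * b :=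
  CStarAlgebra.nonneg_iff_eq_star_mul_self

open scoped Matrix.Norms.L2Operator MatrixOrder ComplexOrder CStarAlgebra in
/-- A completely positive map has a positive Choi matrix, here in factored form. -/
theorem IsCompletelyPositive.exists_choi_factor {E : QubitMap} (hE : IsCompletelyPositive E) :
    ∃ Y : Fin 2 → Fin 2 → Matrix (Fin 2) (Fin 2) ℂ,
      ∀ i j, E (Matrix.single i j 1) = ∑ k, (Y k i)ᴴ * Y k j := by
  obtain ⟨Φ, rfl⟩ := hE
  -- Only row 0 of `X` is nonzero, so `star X * X` is the block matrix of all matrix units; its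
  -- image under `Φ` is the Choi matrix, and 2-positivity suffices.
  let X : CStarMatrix (Fin 2) (Fin 2) (Matrix (Fin 2) (Fin 2) ℂ) :=
    CStarMatrix.ofMatrix (Matrix.of fun k i => if k = 0 then Matrix.single 0 i 1 else 0)
  have h := Φ.map_cstarMatrix_nonneg' 2 (star X * X) (star_mul_self_nonneg X)
  obtain ⟨Y, hY⟩ := NonUnitalCStarAlgebra.nonneg_iff_exists_star_mul_self.mp h
  refine ⟨fun k i => Y k i, fun i j => ?_⟩
  have hX : (star X * X) i j = Matrix.single i j 1 := by
    rw [CStarMatrix.mul_apply, Fin.sum_univ_two, CStarMatrix.star_apply, CStarMatrix.star_apply]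
    simp [X, Matrix.star_eq_conjTranspose]
  have hij := congrFun (congrFun hY i) j
  rw [CStarMatrix.map_apply, hX, CStarMatrix.mul_apply] at hij
  exact hij

open scoped Matrix.Norms.L2Operator MatrixOrder ComplexOrder CStarAlgebra in
theorem isCompletelyPositive_conjMap (K : Matrix (Fin 2) (Fin 2) ℂ) :
    IsCompletelyPositive (conjMap K) := by
  refine ⟨⟨conjMap K, fun k M hM => ?_⟩, rfl⟩
  obtain ⟨Y, rfl⟩ := NonUnitalCStarAlgebra.nonneg_iff_exists_star_mul_self.mp hM
  -- Entrywise, K (Y†Y) K† = (YK†)†(YK†).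
  refine NonUnitalCStarAlgebra.nonneg_iff_exists_star_mul_self.mpr ⟨Y.map fun A => A * Kᴴ, ?_⟩
  ext1 i j
  simp only [CStarMatrix.map_apply, CStarMatrix.mul_apply, CStarMatrix.star_apply, map_sum,
    conjMap_apply, Matrix.star_eq_conjTranspose, conjTranspose_mul, conjTranspose_conjTranspose,
    mul_assoc]

theorem dotPauli_eq (c : Fin 3 → ℂ) :
    dotPauli c = !![c 2, c 0 - Complex.I * c 1; c 0 + Complex.I * c 1, -c 2] := by
  ext i j
  fin_cases i <;> fin_cases j <;>
    simp [dotPauli, pauli, Fin.sum_univ_three, Matrix.sum_apply] <;> ring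

/-- The Pauli matrices and the identity span the operators of a qubit. -/
theorem eq_smul_one_add_dotPauli (K : Matrix (Fin 2) (Fin 2) ℂ) :
    K = ((K 0 0 + K 1 1) / 2) • (1 : Matrix (Fin 2) (Fin 2) ℂ) +
      dotPauli ![(K 0 1 + K 1 0) / 2, Complex.I * (K 0 1 - K 1 0) / 2, (K 0 0 - K 1 1) / 2] := by
  rw [dotPauli_eq]
  ext i j
  fin_cases i <;> fin_cases j <;> simp <;> ring_nf <;> simp <;> ring

theorem IsCompletelyPositive.exists_krausMap {E : QubitMap} (hE : IsCompletelyPositive E) :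
    ∃ (r : ℕ) (a : Fin r → ℂ) (b : Fin r → Fin 3 → ℂ), E = krausMap a b := by
  obtain ⟨Y, hY⟩ := hE.exists_choi_factor
  -- One Kraus operator for each block index and each row inside the block of the Choi factor; the
  -- conjugate appears because the adjoint factor stands on the left.
  let K : Fin 2 × Fin 2 → Matrix (Fin 2) (Fin 2) ℂ := fun s =>
    Matrix.of fun p i => conj (Y s.1 i s.2 p)
  let e : Fin 4 ≃ Fin 2 × Fin 2 := (finProdFinEquiv (m := 2) (n := 2)).symm
  refine ⟨4, fun i => (K (e i) 0 0 + K (e i) 1 1) / 2, fun i =>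
    ![(K (e i) 0 1 + K (e i) 1 0) / 2, Complex.I * (K (e i) 0 1 - K (e i) 1 0) / 2,
      (K (e i) 0 0 - K (e i) 1 1) / 2], ?_⟩
  have hs : ∀ i j, E (Matrix.single i j 1) = ∑ s, conjMap (K s) (Matrix.single i j 1) := by
    intro i j
    rw [hY]
    ext p q
    rw [Matrix.sum_apply, Matrix.sum_apply, Fintype.sum_prod_type]
    refine Finset.sum_congr rfl fun k _ => ?_
    rw [Matrix.mul_apply]
    refine Finset.sum_congr rfl fun l _ => ?_
    simp [conjMap_apply, K, Matrix.mul_apply, Matrix.single, ite_and]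
  refine Matrix.ext_linearMap ℂ fun i j => LinearMap.ext_ring ?_
  simp only [LinearMap.comp_apply, krausMap, LinearMap.sum_apply, ← eq_smul_one_add_dotPauli]
  exact (hs i j).trans (e.sum_comp _).symm

/-! ### Moments of the Bloch vector of a random state -/

/-- The isometry of `ℂ²` given by a unitary matrix. -/
def unitaryIsometry (U : Matrix (Fin 2) (Fin 2) ℂ) (hU : U ∈ Matrix.unitaryGroup (Fin 2) ℂ) :
    EuclideanSpace ℂ (Fin 2) ≃ₗᵢ[ℂ] EuclideanSpace ℂ (Fin 2) :=
  Unitary.linearIsometryEquiv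
    ⟨Matrix.toEuclideanCLM (n := Fin 2) (𝕜 := ℂ) U, Unitary.map_mem _ hU⟩

theorem integral_comp_unitaryAct
    (u : EuclideanSpace ℂ (Fin 2) ≃ₗᵢ[ℂ] EuclideanSpace ℂ (Fin 2)) {g : QubitState → ℝ}
    (hg : Continuous g) :
    ∫ φ, g (unitaryAct u φ) ∂stateMeasure = ∫ φ, g φ ∂stateMeasure := by
  conv_rhs => rw [← stateMeasure_map_unitaryAct u]
  exact (integral_map (measurable_unitaryAct u).aemeasurable
    hg.measurable.aestronglyMeasurable).symm

/-- The Bloch vector of a vector of `ℂ²`. -/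
def blochVec (w : Fin 2 → ℂ) : Fin 3 → ℝ :=
  ![2 * ((w 0).re * (w 1).re + (w 0).im * (w 1).im),
    2 * ((w 0).re * (w 1).im - (w 0).im * (w 1).re),
    (w 0).re ^ 2 + (w 0).im ^ 2 - (w 1).re ^ 2 - (w 1).im ^ 2]

theorem continuous_blochVec (α : Fin 3) :
    Continuous fun φ : QubitState => blochVec φ.1.ofLp α := by
  have h : ∀ i, Continuous fun φ : QubitState => φ.1.ofLp i := fun i => by fun_prop
  have hr : ∀ i, Continuous fun φ : QubitState => (φ.1.ofLp i).re :=
    fun i => Complex.continuous_re.comp (h i)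
  have hi : ∀ i, Continuous fun φ : QubitState => (φ.1.ofLp i).im :=
    fun i => Complex.continuous_im.comp (h i)
  fin_cases α <;> simp only [blochVec] <;> simp <;> fun_prop

theorem QubitState.sum_sq (φ : QubitState) :
    (φ.1.ofLp 0).re ^ 2 + (φ.1.ofLp 0).im ^ 2 + (φ.1.ofLp 1).re ^ 2 + (φ.1.ofLp 1).im ^ 2 = 1 := by
  have h : ‖φ.1‖ ^ 2 = 1 := by simp
  rw [EuclideanSpace.norm_sq_eq, Fin.sum_univ_two, ← Complex.normSq_eq_norm_sq,
    ← Complex.normSq_eq_norm_sq, Complex.normSq_apply, Complex.normSq_apply] at h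
  linarith

/-- The phase gate. -/
def phaseGate : Matrix (Fin 2) (Fin 2) ℂ := !![1, 0; 0, Complex.I]

theorem phaseGate_mem : phaseGate ∈ Matrix.unitaryGroup (Fin 2) ℂ := by
  rw [Matrix.mem_unitaryGroup_iff]
  ext i j
  fin_cases i <;> fin_cases j <;>
    simp [phaseGate, Matrix.mul_apply, Matrix.star_eq_conjTranspose]

/-- The Hadamard gate. -/
def hadamardGate : Matrix (Fin 2) (Fin 2) ℂ :=
  ((√2 / 2 : ℝ) : ℂ) • !![1, 1; 1, -1]

theorem hadamardGate_mem : hadamardGate ∈ Matrix.unitaryGroup (Fin 2) ℂ := by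
  have h : ((√2 / 2 : ℝ) : ℂ) * ((√2 / 2 : ℝ) : ℂ) = 1 / 2 := by
    rw [← Complex.ofReal_mul]
    have : (√2 / 2) * (√2 / 2) = (1 / 2 : ℝ) := by
      rw [div_mul_div_comm, Real.mul_self_sqrt (by norm_num)]; norm_num
    rw [this]; norm_num
  rw [Matrix.mem_unitaryGroup_iff, Matrix.star_eq_conjTranspose, hadamardGate, conjTranspose_smul,
    smul_mul_smul_comm, Complex.star_def, Complex.conj_ofReal, h]
  have hH : (!![1, 1; 1, -1] : Matrix (Fin 2) (Fin 2) ℂ)ᴴ = !![1, 1; 1, -1] := by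
    ext i j
    fin_cases i <;> fin_cases j <;> simp
  rw [hH]
  ext i j
  fin_cases i <;> fin_cases j <;> simp <;> norm_num

theorem blochVec_phaseGate (w : Fin 2 → ℂ) :
    blochVec (phaseGate *ᵥ w) = ![-blochVec w 1, blochVec w 0, blochVec w 2] := by
  ext α
  fin_cases α <;> simp [blochVec, phaseGate, Matrix.mulVec, dotProduct] <;> ring

theorem blochVec_hadamardGate (w : Fin 2 → ℂ) :
    blochVec (hadamardGate *ᵥ w) = ![blochVec w 2, -blochVec w 1, blochVec w 0] := by
  have h : (√2 : ℝ) ^ 2 = 2 := Real.sq_sqrt (by norm_num)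
  ext α
  fin_cases α <;>
    simp [blochVec, hadamardGate, Matrix.mulVec, dotProduct] <;> ring_nf <;> rw [h] <;> ring

theorem integrable_of_continuous {g : QubitState → ℝ} (hg : Continuous g) :
    Integrable g stateMeasure :=
  hg.integrable_of_hasCompactSupport (HasCompactSupport.of_compactSpace g)

theorem integral_blochVec_phase {g : (Fin 3 → ℝ) → ℝ} (hg : Continuous g) :
    ∫ φ : QubitState, g ![-blochVec φ.1.ofLp 1, blochVec φ.1.ofLp 0, blochVec φ.1.ofLp 2]
      ∂stateMeasure = ∫ φ : QubitState, g (blochVec φ.1.ofLp) ∂stateMeasure := by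
  simp only [← blochVec_phaseGate]
  exact integral_comp_unitaryAct (unitaryIsometry phaseGate phaseGate_mem)
    (hg.comp (continuous_pi continuous_blochVec))

theorem integral_blochVec_hadamard {g : (Fin 3 → ℝ) → ℝ} (hg : Continuous g) :
    ∫ φ : QubitState, g ![blochVec φ.1.ofLp 2, -blochVec φ.1.ofLp 1, blochVec φ.1.ofLp 0]
      ∂stateMeasure = ∫ φ : QubitState, g (blochVec φ.1.ofLp) ∂stateMeasure := by
  simp only [← blochVec_hadamardGate]
  exact integral_comp_unitaryAct (unitaryIsometry hadamardGate hadamardGate_mem)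
    (hg.comp (continuous_pi continuous_blochVec))

/-- The phase gate is a quarter turn about the third axis, which kills the first two means; the
Hadamard gate exchanges the first and third axes. -/
theorem integral_blochVec (α : Fin 3) :
    ∫ φ : QubitState, blochVec φ.1.ofLp α ∂stateMeasure = 0 := by
  have h0 := integral_blochVec_phase (g := fun r => r 0) (by fun_prop)
  have h1 := integral_blochVec_phase (g := fun r => r 1) (by fun_prop)
  have h2 := integral_blochVec_hadamard (g := fun r => r 0) (by fun_prop)
  simp [integral_neg] at h0 h1 h2
  fin_cases α <;> simp <;> linarith

/-- The same two rotations kill the mixed moments and equate the three squares, whose sum is 1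
because pure states lie on the unit Bloch sphere. -/
theorem integral_blochVec_mul (α β : Fin 3) :
    ∫ φ : QubitState, blochVec φ.1.ofLp α * blochVec φ.1.ofLp β ∂stateMeasure =
      if α = β then 1 / 3 else 0 := by
  have h01 := integral_blochVec_phase (g := fun r => r 0 * r 1) (by fun_prop)
  have h02 := integral_blochVec_phase (g := fun r => r 0 * r 2) (by fun_prop)
  have h12 := integral_blochVec_phase (g := fun r => r 1 * r 2) (by fun_prop)
  have h00 := integral_blochVec_phase (g := fun r => r 0 * r 0) (by fun_prop)
  have h22 := integral_blochVec_hadamard (g := fun r => r 0 * r 0) (by fun_prop)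
  simp [integral_neg] at h01 h02 h12 h00 h22
  have hI : ∀ α β, Integrable (fun φ : QubitState => blochVec φ.1.ofLp α * blochVec φ.1.ofLp β)
      stateMeasure := fun α β =>
    integrable_of_continuous ((continuous_blochVec α).mul (continuous_blochVec β))
  have hsum : ∫ φ : QubitState, blochVec φ.1.ofLp 0 * blochVec φ.1.ofLp 0 ∂stateMeasure +
      ∫ φ : QubitState, blochVec φ.1.ofLp 1 * blochVec φ.1.ofLp 1 ∂stateMeasure +
      ∫ φ : QubitState, blochVec φ.1.ofLp 2 * blochVec φ.1.ofLp 2 ∂stateMeasure = 1 := by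
    rw [← integral_add (hI _ _) (hI _ _),
      ← integral_add (by exact (hI _ _).add (hI _ _)) (hI _ _)]
    have h1 : ∀ φ : QubitState, blochVec φ.1.ofLp 0 * blochVec φ.1.ofLp 0 +
        blochVec φ.1.ofLp 1 * blochVec φ.1.ofLp 1 + blochVec φ.1.ofLp 2 * blochVec φ.1.ofLp 2 =
        1 := fun φ => by
      -- The squared length of the Bloch vector of w is the fourth power of the norm of w.
      have h := congrArg (fun t => t ^ 2) φ.sum_sq
      simp only [one_pow] at h
      refine Eq.trans ?_ h
      simp [blochVec]
      ring
    simp [h1]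
  have hc : ∀ α β : Fin 3,
      ∫ φ : QubitState, blochVec φ.1.ofLp α * blochVec φ.1.ofLp β ∂stateMeasure =
      ∫ φ : QubitState, blochVec φ.1.ofLp β * blochVec φ.1.ofLp α ∂stateMeasure :=
    fun α β => by simp only [mul_comm]
  have e01 := hc 0 1
  have e02 := hc 0 2
  have e12 := hc 1 2
  fin_cases α <;> fin_cases β <;> simp <;> linarith

/-! ### Average fidelity and the trace of the Bloch matrix -/

theorem vecMulVec_eq_bloch (φ : QubitState) :
    vecMulVec φ.1.ofLp (star φ.1.ofLp) = (1 / 2 : ℂ) •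
      ((1 : Matrix (Fin 2) (Fin 2) ℂ) + ∑ α, (blochVec φ.1.ofLp α : ℂ) • pauli α) := by
  have h := φ.sum_sq
  ext i j
  fin_cases i <;> fin_cases j <;>
    simp [vecMulVec, Fin.sum_univ_three, pauli, blochVec, Complex.ext_iff, pow_two] <;>
    first | (constructor <;> linarith) | linarith

theorem dotProduct_mulVec_eq_trace (w : Fin 2 → ℂ) (A : Matrix (Fin 2) (Fin 2) ℂ) :
    star w ⬝ᵥ A *ᵥ w = (vecMulVec w (star w) * A).trace := by
  simp [Matrix.trace, Matrix.mul_apply, dotProduct, mulVec, vecMulVec, Fin.sum_univ_two]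
  ring

theorem fidelity_integrand_eq (E : QubitMap) (φ : QubitState) :
    (star φ.1.ofLp ⬝ᵥ (E (vecMulVec φ.1.ofLp (star φ.1.ofLp)) *ᵥ φ.1.ofLp)).re =
      1 / 4 * ((E 1).trace.re + ∑ α, blochVec φ.1.ofLp α * (E (pauli α)).trace.re +
        (∑ β, blochVec φ.1.ofLp β * (pauli β * E 1).trace.re +
        ∑ β, ∑ α, blochVec φ.1.ofLp β * blochVec φ.1.ofLp α *
          (pauli β * E (pauli α)).trace.re)) := by
  rw [dotProduct_mulVec_eq_trace, vecMulVec_eq_bloch]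
  simp only [map_smul, map_add, smul_mul_assoc, mul_smul_comm, add_mul, mul_add, one_mul,
    trace_smul, trace_add, smul_eq_mul, Fin.sum_univ_three]
  simp
  ring

/-- The average fidelity in terms of the affine map on the Bloch ball. -/
theorem avgFidelity_eq (E : QubitMap) :
    avgFidelity E = 1 / 4 * (E 1).trace.re + 1 / 6 * (blochMatrix E).trace := by
  have hc := continuous_blochVec
  simp only [avgFidelity, fidelity_integrand_eq]
  rw [integral_const_mul, integral_add, integral_add, integral_add, integral_finsetSum,
    integral_finsetSum, integral_finsetSum]
  · have h : ∀ β, ∫ φ : QubitState, ∑ α, blochVec φ.1.ofLp β * blochVec φ.1.ofLp α *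
          (pauli β * E (pauli α)).trace.re ∂stateMeasure =
        1 / 3 * (pauli β * E (pauli β)).trace.re := fun β => by
      rw [integral_finsetSum _ fun α _ => integrable_of_continuous (by fun_prop)]
      simp [integral_mul_const, integral_blochVec_mul]
    simp only [h, integral_mul_const, integral_blochVec]
    simp [Matrix.trace_fin_three, blochMatrix, Fin.sum_univ_three, probReal_univ]
    ring
  all_goals first
    | exact fun _ _ => integrable_of_continuous (by fun_prop)
    | exact integrable_of_continuous (by fun_prop)

/-! ### Bloch matrix of a Kraus map -/

theorem blochMatrix_add (E F : QubitMap) :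
    blochMatrix (E + F) = blochMatrix E + blochMatrix F := by
  ext α β
  simp [blochMatrix, mul_add]

theorem blochMatrix_sum {ι : Type*} (s : Finset ι) (E : ι → QubitMap) :
    blochMatrix (∑ i ∈ s, E i) = ∑ i ∈ s, blochMatrix (E i) := by
  classical
  induction s using Finset.induction_on with
  | empty => ext; simp [blochMatrix]
  | insert i s hi ih => rw [Finset.sum_insert hi, Finset.sum_insert hi, blochMatrix_add, ih]

/-- The antisymmetric matrix `ε_{αβγ} v_γ`. -/
def leviCivitaMatrix (v : Fin 3 → ℝ) : Matrix (Fin 3) (Fin 3) ℝ :=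
  !![0, v 2, -v 1; -v 2, 0, v 0; v 1, -v 0, 0]

theorem krausB_apply {r : ℕ} (b : Fin r → Fin 3 → ℂ) (α β : Fin 3) :
    krausB b α β = ∑ i, ((b i α).re * (b i β).re + (b i α).im * (b i β).im) := by
  simp only [krausB, Matrix.of_apply, one_div]
  rw [show (2⁻¹ : ℂ) = ((2⁻¹ : ℝ) : ℂ) by simp, Complex.re_ofReal_mul, Complex.re_sum,
    Finset.mul_sum]
  refine Finset.sum_congr rfl fun i _ => ?_
  simp
  ring

theorem krausB_comm {r : ℕ} (b : Fin r → Fin 3 → ℂ) (α β : Fin 3) :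
    krausB b α β = krausB b β α := by
  simp only [krausB_apply, mul_comm]

theorem krausV_apply {r : ℕ} (a : Fin r → ℂ) (b : Fin r → Fin 3 → ℂ) (α : Fin 3) :
    krausV a b α = ∑ i, 2 * ((a i).im * (b i α).re - (a i).re * (b i α).im) := by
  simp only [krausV, Finset.mul_sum, Complex.re_sum]
  refine Finset.sum_congr rfl fun i _ => ?_
  simp
  ring

/-- The terms quadratic in a or in b give the symmetric part; the cross terms enter through
commutators with b·σ and give the antisymmetric part. -/
theorem blochMatrix_conjMap (a : ℂ) (b : Fin 3 → ℂ) :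
    blochMatrix (conjMap (a • (1 : Matrix (Fin 2) (Fin 2) ℂ) + dotPauli b)) =
      (a.re ^ 2 + a.im ^ 2 - ∑ γ, ((b γ).re * (b γ).re + (b γ).im * (b γ).im)) •
        (1 : Matrix (Fin 3) (Fin 3) ℝ) +
      (2 : ℝ) • Matrix.of (fun α β => (b α).re * (b β).re + (b α).im * (b β).im) -
      leviCivitaMatrix fun α => 2 * (a.im * (b α).re - a.re * (b α).im) := by
  rw [dotPauli_eq]
  ext α β
  fin_cases α <;> fin_cases β <;>
    simp [blochMatrix, conjMap_apply, pauli, leviCivitaMatrix, Matrix.trace_fin_two,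
      Matrix.mul_apply, Fin.sum_univ_two, Fin.sum_univ_three] <;> ring

/-- The affine matrix of a channel in terms of a Kraus representation. -/
theorem blochMatrix_krausMap {r : ℕ} (a : Fin r → ℂ) (b : Fin r → Fin 3 → ℂ) :
    blochMatrix (krausMap a b) =
      (∑ i, ((a i).re ^ 2 + (a i).im ^ 2) - (krausB b).trace) • (1 : Matrix (Fin 3) (Fin 3) ℝ) +
      (2 : ℝ) • krausB b - leviCivitaMatrix (krausV a b) := by
  rw [krausMap, blochMatrix_sum]
  simp only [blochMatrix_conjMap, Finset.sum_add_distrib, Finset.sum_sub_distrib,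
    ← Finset.smul_sum, ← Finset.sum_smul]
  congr 1
  · congr 1
    · congr 2
      simp only [Matrix.trace, Matrix.diag_apply, krausB_apply, ← Finset.sum_add_distrib]
      rw [Finset.sum_comm]
    · congr 1
      ext α β
      simp [krausB_apply, Matrix.sum_apply]
  · ext α β
    rw [Matrix.sum_apply]
    fin_cases α <;> fin_cases β <;> simp [leviCivitaMatrix, krausV_apply]

/-! ### Composition of channels on the Bloch ball -/

theorem krausMap_conjTranspose {r : ℕ} (a : Fin r → ℂ) (b : Fin r → Fin 3 → ℂ)
    (ρ : Matrix (Fin 2) (Fin 2) ℂ) : krausMap a b ρᴴ = (krausMap a b ρ)ᴴ := by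
  simp [krausMap, conjMap_apply, conjTranspose_sum, mul_assoc]

theorem IsQuantumChannel.map_conjTranspose {E : QubitMap} (hE : IsQuantumChannel E)
    (ρ : Matrix (Fin 2) (Fin 2) ℂ) : E ρᴴ = (E ρ)ᴴ := by
  obtain ⟨r, a, b, rfl⟩ := hE.1.exists_krausMap
  exact krausMap_conjTranspose a b ρ

theorem pauli_conjTranspose (α : Fin 3) : (pauli α)ᴴ = pauli α := by
  ext i j
  fin_cases α <;> fin_cases i <;> fin_cases j <;> simp [pauli]

theorem trace_pauli (α : Fin 3) : (pauli α).trace = 0 := by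
  fin_cases α <;> simp [pauli, Matrix.trace_fin_two]

/-- A traceless Hermitian operator of a qubit is a real combination of the Pauli matrices. -/
theorem eq_sum_smul_pauli {X : Matrix (Fin 2) (Fin 2) ℂ} (hX : Xᴴ = X) (ht : X.trace = 0) :
    X = ∑ α, ((((1 / 2 : ℂ) * (pauli α * X).trace).re : ℝ) : ℂ) • pauli α := by
  have h00 := congrFun (congrFun hX 0) 0
  have h01 := congrFun (congrFun hX 0) 1
  have h11 := congrFun (congrFun hX 1) 1
  simp only [conjTranspose_apply, Complex.star_def, Complex.ext_iff, Complex.conj_re,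
    Complex.conj_im] at h00 h01 h11
  rw [Matrix.trace_fin_two, Complex.ext_iff] at ht
  simp only [Complex.add_re, Complex.add_im, Complex.zero_re, Complex.zero_im] at ht
  obtain ⟨_, h00⟩ := h00
  obtain ⟨h01, h01'⟩ := h01
  obtain ⟨_, h11⟩ := h11
  obtain ⟨ht, _⟩ := ht
  ext i j
  fin_cases i <;> fin_cases j <;>
    simp [Fin.sum_univ_three, pauli, Matrix.trace_fin_two, Complex.ext_iff, Matrix.vecMul,
      dotProduct] <;>
    constructor <;> linarith

theorem IsQuantumChannel.map_pauli {E : QubitMap} (hE : IsQuantumChannel E) (β : Fin 3) :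
    E (pauli β) = ∑ α, (blochMatrix E α β : ℂ) • pauli α :=
  eq_sum_smul_pauli (by rw [← hE.map_conjTranspose, pauli_conjTranspose])
    (by rw [hE.2, trace_pauli])

/-- A channel maps Pauli matrices to real combinations of Pauli matrices, so the outer map may be
any linear map: it is never applied to the identity. -/
theorem blochMatrix_comp (N : QubitMap) {E : QubitMap} (hE : IsQuantumChannel E) :
    blochMatrix (N ∘ₗ E) = blochMatrix N * blochMatrix E := by
  ext α β
  rw [Matrix.mul_apply]
  conv_lhs => rw [blochMatrix, Matrix.of_apply, LinearMap.comp_apply, hE.map_pauli]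
  simp only [map_sum, map_smul, Finset.mul_sum, mul_smul_comm, trace_sum, trace_smul, smul_eq_mul,
    Complex.re_sum]
  refine Finset.sum_congr rfl fun γ _ => ?_
  rw [mul_left_comm, Complex.re_ofReal_mul, mul_comm]
  rfl

theorem avgFidelity_of_trace {E : QubitMap} (hE : ∀ ρ, (E ρ).trace = ρ.trace) :
    avgFidelity E = 1 / 2 + 1 / 6 * (blochMatrix E).trace := by
  rw [avgFidelity_eq, hE]
  simp
  norm_num

theorem avgFidelity_comp {N E : QubitMap} (hN : IsQuantumChannel N) (hE : IsQuantumChannel E) :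
    avgFidelity (N ∘ₗ E) = 1 / 2 + 1 / 6 * (blochMatrix N * blochMatrix E).trace := by
  rw [avgFidelity_of_trace fun ρ => by rw [LinearMap.comp_apply, hN.2, hE.2],
    blochMatrix_comp N hE]

/-! ### The gain as a quadratic form -/

/-- Trace preservation normalizes the Kraus operators. -/
theorem sum_add_trace_krausB {r : ℕ} {a : Fin r → ℂ} {b : Fin r → Fin 3 → ℂ}
    (h : ∀ ρ, (krausMap a b ρ).trace = ρ.trace) :
    ∑ i, ((a i).re ^ 2 + (a i).im ^ 2) + (krausB b).trace = 1 := by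
  have h1 := congrArg Complex.re (h 1)
  have hK : ∀ (a : ℂ) (b : Fin 3 → ℂ), (conjMap (a • (1 : Matrix (Fin 2) (Fin 2) ℂ) +
      dotPauli b) 1).trace.re = 2 * (a.re ^ 2 + a.im ^ 2 +
        ∑ γ, ((b γ).re * (b γ).re + (b γ).im * (b γ).im)) := fun a b => by
    simp [conjMap_apply, dotPauli_eq, Matrix.trace_fin_two, Matrix.mul_apply, Fin.sum_univ_three,
      Fin.sum_univ_two]
    ring
  simp only [krausMap, LinearMap.sum_apply, trace_sum, Complex.re_sum, hK] at h1
  rw [← Finset.mul_sum, Finset.sum_add_distrib, Finset.sum_comm] at h1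
  simp only [← krausB_apply] at h1
  simp at h1
  rw [Matrix.trace]
  simp only [Matrix.diag_apply]
  linarith

theorem pauliUnitary_eq (x₀ : ℝ) (x : Fin 3 → ℝ) :
    pauliUnitary x₀ x = (x₀ : ℂ) • (1 : Matrix (Fin 2) (Fin 2) ℂ) +
      dotPauli fun α => Complex.I * (x α : ℂ) := by
  rw [pauliUnitary, dotPauli, dotPauli, Finset.smul_sum]
  simp only [smul_smul]

/-- The quadratic form of `Q`. -/
theorem krausQ_quadForm {r : ℕ} (a : Fin r → ℂ) (b : Fin r → Fin 3 → ℂ) (x₀ : ℝ)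
    (x : Fin 3 → ℝ) :
    fourVec x₀ x ⬝ᵥ krausQ a b *ᵥ fourVec x₀ x =
      x₀ * (krausV a b ⬝ᵥ x) + x ⬝ᵥ krausB b *ᵥ x + ((krausB b).trace - 1) * (x ⬝ᵥ x) := by
  simp [krausQ, fourVec, krausBhat, Matrix.mulVec, dotProduct, Fin.sum_univ_three, Matrix.add_apply]
  ring

/-- Composition with the conjugation by `x₀ + i x · σ`, as a quadratic form in `(x₀, x)`. -/
theorem trace_blochMatrix_pauliUnitary_mul {r : ℕ} {a : Fin r → ℂ} {b : Fin r → Fin 3 → ℂ}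
    (h : ∀ ρ, (krausMap a b ρ).trace = ρ.trace) (x₀ : ℝ) (x : Fin 3 → ℝ) :
    (blochMatrix (conjMap (pauliUnitary x₀ x)) * blochMatrix (krausMap a b)).trace =
      4 * (fourVec x₀ x ⬝ᵥ krausQ a b *ᵥ fourVec x₀ x) +
      (x₀ ^ 2 + x ⬝ᵥ x) * (blochMatrix (krausMap a b)).trace := by
  -- Normalization replaces ∑|aᵢ|² by 1 - Tr B, which produces the shift -I + Tr(B) I in
  -- `krausBhat`; the product of the two antisymmetric parts produces the term x₀ (v·x).
  have hn := sum_add_trace_krausB h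
  rw [krausQ_quadForm, pauliUnitary_eq, blochMatrix_conjMap, blochMatrix_krausMap,
    eq_sub_of_add_eq hn]
  have h10 := krausB_comm b 1 0
  have h20 := krausB_comm b 2 0
  have h21 := krausB_comm b 2 1
  generalize krausB b = B at h10 h20 h21 ⊢
  generalize krausV a b = v
  simp [Matrix.trace_fin_three, Matrix.mul_apply, Fin.sum_univ_three, leviCivitaMatrix,
    dotProduct, mulVec, h10, h20, h21]
  ring

/-- Write the Kraus operator as V₁ + iV₂ with V₁, V₂ in the real span of 1 and the iσ (the
quaternions). The cross terms send each Pauli matrix to a multiple of the identity, which affects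
only the translation of the Bloch ball. -/
theorem blochMatrix_conjMap_eq_add (c : ℂ) (d : Fin 3 → ℂ) :
    blochMatrix (conjMap (c • (1 : Matrix (Fin 2) (Fin 2) ℂ) + dotPauli d)) =
      blochMatrix (conjMap (pauliUnitary c.re fun α => (d α).im)) +
      blochMatrix (conjMap (pauliUnitary c.im fun α => -(d α).re)) := by
  rw [pauliUnitary_eq, pauliUnitary_eq, blochMatrix_conjMap, blochMatrix_conjMap,
    blochMatrix_conjMap]
  ext α β
  fin_cases α <;> fin_cases β <;>
    simp [leviCivitaMatrix, Fin.sum_univ_three] <;> ring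

/-! ### The largest eigenvalue as a maximum on the sphere -/

/-- A real symmetric matrix has a unit eigenvector maximizing its quadratic form. -/
theorem exists_maximal_eigenvector {ι : Type*} [Fintype ι] [DecidableEq ι] [Nonempty ι]
    {Q : Matrix ι ι ℝ} (hQ : Qᵀ = Q) :
    ∃ (lam : ℝ) (x : ι → ℝ), x ⬝ᵥ x = 1 ∧ Q *ᵥ x = lam • x ∧
      ∀ y, y ⬝ᵥ Q *ᵥ y ≤ lam * (y ⬝ᵥ y) := by
  have hcont : Continuous fun x : ι → ℝ => x ⬝ᵥ x := by unfold dotProduct; fun_prop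
  have hcomp : IsCompact {x : ι → ℝ | x ⬝ᵥ x = 1} := by
    refine Metric.isCompact_of_isClosed_isBounded (isClosed_eq hcont continuous_const) ?_
    refine (Metric.isBounded_closedBall (x := (0 : ι → ℝ)) (r := 1)).subset fun x hx => ?_
    rw [mem_closedBall_zero_iff, pi_norm_le_iff_of_nonneg zero_le_one]
    intro i
    rw [Real.norm_eq_abs, abs_le_one_iff_mul_self_le_one, ← show x ⬝ᵥ x = 1 from hx]
    exact Finset.single_le_sum (f := fun i => x i * x i) (fun j _ => mul_self_nonneg _)
      (Finset.mem_univ i)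
  obtain ⟨i⟩ := ‹Nonempty ι›
  obtain ⟨x, hx, hmax⟩ := hcomp.exists_isMaxOn ⟨Pi.single i 1, by simp⟩
    (f := fun x => x ⬝ᵥ Q *ᵥ x) (by unfold dotProduct mulVec dotProduct; fun_prop)
  have hx1 : x ⬝ᵥ x = 1 := hx
  have hle : ∀ y, y ⬝ᵥ Q *ᵥ y ≤ (x ⬝ᵥ Q *ᵥ x) * (y ⬝ᵥ y) := by
    intro y
    rcases eq_or_ne y 0 with rfl | hy
    · simp
    have hpos : 0 < y ⬝ᵥ y := lt_of_le_of_ne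
      (Finset.sum_nonneg fun j _ => mul_self_nonneg _)
      fun h => hy (dotProduct_self_eq_zero.mp h.symm)
    have hs : √(y ⬝ᵥ y) ^ 2 = y ⬝ᵥ y := Real.sq_sqrt hpos.le
    have hs0 : √(y ⬝ᵥ y) ≠ 0 := (Real.sqrt_pos.mpr hpos).ne'
    have hm := hmax (a := (√(y ⬝ᵥ y))⁻¹ • y) (by
      simp only [Set.mem_ofPred_eq, smul_dotProduct, dotProduct_smul, smul_eq_mul]
      field_simp
      exact hs.symm)
    simp only [Set.mem_ofPred_eq, mulVec_smul, smul_dotProduct, dotProduct_smul, smul_eq_mul] at hm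
    rw [← mul_assoc, ← mul_inv, ← pow_two, hs, inv_mul_le_iff₀ hpos] at hm
    linarith
  refine ⟨x ⬝ᵥ Q *ᵥ x, x, hx1, ?_, hle⟩
  -- A positive semidefinite matrix annihilates every vector on which its form vanishes; this turns
  -- the maximizer into an eigenvector without differentiating.
  have hpsd : ((x ⬝ᵥ Q *ᵥ x) • (1 : Matrix ι ι ℝ) - Q).PosSemidef := by
    refine Matrix.PosSemidef.of_dotProduct_mulVec_nonneg ?_ fun y => ?_
    · simp [Matrix.IsHermitian, conjTranspose_eq_transpose_of_trivial, hQ]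
    · have := hle y
      simp [sub_mulVec, smul_mulVec, dotProduct_sub]
      linarith
  have h0 := (hpsd.dotProduct_mulVec_zero_iff x).mp (by
    simp [sub_mulVec, smul_mulVec, dotProduct_sub, hx1])
  rw [sub_mulVec, smul_mulVec, one_mulVec] at h0
  exact (sub_eq_zero.mp h0).symm

/-- An eigenvalue that bounds the quadratic form is the largest eigenvalue. -/
theorem isGreatest_hasEigenvalue {ι : Type*} [Fintype ι] [DecidableEq ι]
    {Q : Matrix ι ι ℝ} {lam : ℝ} {x : ι → ℝ} (hx : x ≠ 0) (hQx : Q *ᵥ x = lam • x)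
    (hle : ∀ y, y ⬝ᵥ Q *ᵥ y ≤ lam * (y ⬝ᵥ y)) :
    IsGreatest {μ : ℝ | Module.End.HasEigenvalue (Matrix.toLin' Q) μ} lam := by
  constructor
  · exact Module.End.hasEigenvalue_of_hasEigenvector
      ⟨Module.End.mem_eigenspace_iff.mpr (by rw [toLin'_apply, hQx]), hx⟩
  · intro μ hμ
    obtain ⟨y, hy, hy0⟩ := hμ.exists_hasEigenvector
    have hy' := Module.End.mem_eigenspace_iff.mp hy
    rw [toLin'_apply] at hy'
    have h := hle y
    rw [hy', dotProduct_smul, smul_eq_mul] at h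
    have hpos : 0 < y ⬝ᵥ y := lt_of_le_of_ne
      (Finset.sum_nonneg fun j _ => mul_self_nonneg _)
      fun h => hy0 (dotProduct_self_eq_zero.mp h.symm)
    exact le_of_mul_le_mul_right h hpos

/-! ### Unitarity and the exponential form -/

theorem dotPauli_mul_self {n : Fin 3 → ℝ} (hn : n ⬝ᵥ n = 1) :
    dotPauli (fun α => (n α : ℂ)) * dotPauli (fun α => (n α : ℂ)) = 1 := by
  have h : (n 0 : ℂ) ^ 2 + (n 1 : ℂ) ^ 2 + (n 2 : ℂ) ^ 2 = 1 := by
    rw [dotProduct, Fin.sum_univ_three] at hn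
    exact_mod_cast (by linarith : n 0 ^ 2 + n 1 ^ 2 + n 2 ^ 2 = 1)
  ext i j
  fin_cases i <;> fin_cases j <;>
    simp [dotPauli, pauli, Fin.sum_univ_three, Matrix.mul_apply, Fin.sum_univ_two] <;>
    first | ring1 | linear_combination h - (n 1 : ℂ) ^ 2 * Complex.I_mul_I

open scoped Matrix.Norms.L2Operator in
/-- Euler's formula for an involution. -/
theorem exp_smul_of_mul_self_eq_one {P : Matrix (Fin 2) (Fin 2) ℂ} (hP : P * P = 1) (ϕ : ℝ) :
    NormedSpace.exp ((Complex.I * (ϕ : ℂ)) • P) =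
      (Real.cos ϕ : ℂ) • (1 : Matrix (Fin 2) (Fin 2) ℂ) +
        Complex.I • (Real.sin ϕ : ℂ) • P := by
  set z : ℂ := Complex.I * ϕ
  have hp : ∀ w : ℂ, HasSum (fun n : ℕ => ((n.factorial : ℂ)⁻¹) * w ^ n) (Complex.exp w) :=
    fun w => by
      have := NormedSpace.exp_series_hasSum_exp' (𝕂 := ℂ) w
      rw [← Complex.exp_eq_exp_ℂ] at this
      simpa using this
  have h1 := ((hp z).smul_const ((1 / 2 : ℂ) • (1 + P))).add
    ((hp (-z)).smul_const ((1 / 2 : ℂ) • (1 - P)))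
  have h2 := NormedSpace.exp_series_hasSum_exp' (𝕂 := ℂ) (z • P)
  -- (1 ± P)/2 are the spectral projections of `P` for ±1, so the series splits into two scalar
  -- exponential series.
  have hpow : ∀ n : ℕ, P ^ n = (1 / 2 : ℂ) • (1 + P) + (-1 : ℂ) ^ n • (1 / 2 : ℂ) • (1 - P) := by
    intro n
    induction n with
    | zero => simp only [pow_zero]; module
    | succ n ih =>
      rw [pow_succ, ih]
      simp only [add_mul, smul_mul_assoc, sub_mul, one_mul, hP, pow_succ]
      module
  have h3 : ∀ n : ℕ, ((n.factorial : ℂ)⁻¹) • (z • P) ^ n =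
      (((n.factorial : ℂ)⁻¹) * z ^ n) • ((1 / 2 : ℂ) • (1 + P)) +
      (((n.factorial : ℂ)⁻¹) * (-z) ^ n) • ((1 / 2 : ℂ) • (1 - P)) := fun n => by
    rw [smul_pow, hpow, neg_pow]
    module
  simp only [h3] at h2
  rw [h2.unique h1, Complex.ofReal_cos, Complex.ofReal_sin, Complex.cos, Complex.sin]
  simp only [z, mul_comm Complex.I (ϕ : ℂ), neg_mul]
  match_scalars
  · ring
  · linear_combination (Complex.exp (ϕ * Complex.I) - Complex.exp (-(ϕ * Complex.I))) / 2 *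
      Complex.I_mul_I

theorem pauliUnitary_mem {x₀ : ℝ} {x : Fin 3 → ℝ} (h : x₀ ^ 2 + x ⬝ᵥ x = 1) :
    pauliUnitary x₀ x ∈ Matrix.unitaryGroup (Fin 2) ℂ := by
  rw [dotProduct, Fin.sum_univ_three] at h
  rw [Matrix.mem_unitaryGroup_iff, Matrix.star_eq_conjTranspose]
  ext i j
  fin_cases i <;> fin_cases j <;>
    simp [pauliUnitary, dotPauli, pauli, Fin.sum_univ_three, Matrix.mul_apply, Fin.sum_univ_two,
      Complex.ext_iff] <;>
    constructor <;> linarith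

theorem exists_cos_sin {x₀ : ℝ} {x : Fin 3 → ℝ} (h : x₀ ^ 2 + x ⬝ᵥ x = 1) :
    ∃ (ϕ : ℝ) (n : Fin 3 → ℝ), n ⬝ᵥ n = 1 ∧ x₀ = Real.cos ϕ ∧ x = Real.sin ϕ • n := by
  have hnn : 0 ≤ x ⬝ᵥ x := Finset.sum_nonneg fun j _ => mul_self_nonneg _
  have hcos : Real.cos (Real.arccos x₀) = x₀ := Real.cos_arccos (by nlinarith) (by nlinarith)
  have hsin : Real.sin (Real.arccos x₀) = √(x ⬝ᵥ x) := by
    rw [Real.sin_arccos, ← h, add_sub_cancel_left]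
  refine ⟨Real.arccos x₀, ?_⟩
  rw [hcos, hsin]
  rcases eq_or_ne x 0 with rfl | hx
  -- Here the sine vanishes, so any unit vector serves as axis.
  · exact ⟨Pi.single 0 1, by simp, rfl, by simp⟩
  · have hs0 : √(x ⬝ᵥ x) ≠ 0 :=
      (Real.sqrt_pos.mpr (lt_of_le_of_ne hnn fun h => hx (dotProduct_self_eq_zero.mp h.symm))).ne'
    refine ⟨(√(x ⬝ᵥ x))⁻¹ • x, ?_, rfl, by rw [smul_inv_smul₀ hs0]⟩
    simp only [smul_dotProduct, dotProduct_smul, smul_eq_mul]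
    field_simp
    exact (Real.sq_sqrt hnn).symm

theorem pauliUnitary_eq_exp {ϕ : ℝ} {n : Fin 3 → ℝ} (hn : n ⬝ᵥ n = 1) :
    pauliUnitary (Real.cos ϕ) (Real.sin ϕ • n) =
      NormedSpace.exp ((Complex.I * (ϕ : ℂ)) • dotPauli fun α => (n α : ℂ)) := by
  rw [exp_smul_of_mul_self_eq_one (dotPauli_mul_self hn), pauliUnitary]
  congr 2
  simp only [dotPauli, Finset.smul_sum, smul_smul, Pi.smul_apply, smul_eq_mul, Complex.ofReal_mul]

/-! ### The bound over all channels and the theorem -/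

theorem krausQ_transpose {r : ℕ} (a : Fin r → ℂ) (b : Fin r → Fin 3 → ℂ) :
    (krausQ a b)ᵀ = krausQ a b := by
  have hB : (krausBhat b)ᵀ = krausBhat b := by
    have h : (krausB b)ᵀ = krausB b := by
      ext α β
      exact krausB_comm b β α
    simp [krausBhat, h]
  rw [krausQ, transpose_smul, fromBlocks_transpose, transpose_zero, transpose_smul, hB,
    transpose_replicateRow, transpose_replicateCol]

theorem fourVec_dotProduct_self (x₀ : ℝ) (x : Fin 3 → ℝ) :
    fourVec x₀ x ⬝ᵥ fourVec x₀ x = x₀ ^ 2 + x ⬝ᵥ x := by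
  simp [fourVec, dotProduct, pow_two]

theorem exists_eq_fourVec (y : Unit ⊕ Fin 3 → ℝ) : ∃ x₀ x, y = fourVec x₀ x :=
  ⟨y (Sum.inl ()), fun α => y (Sum.inr α), by ext (_ | _) <;> rfl⟩

theorem isQuantumChannel_conjMap {V : Matrix (Fin 2) (Fin 2) ℂ}
    (hV : V ∈ Matrix.unitaryGroup (Fin 2) ℂ) : IsQuantumChannel (conjMap V) := by
  refine ⟨isCompletelyPositive_conjMap V, fun ρ => ?_⟩
  rw [conjMap_apply, trace_mul_comm, ← mul_assoc, ← Matrix.star_eq_conjTranspose,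
    Matrix.mem_unitaryGroup_iff'.mp hV, one_mul]

/-- The largest value of the quadratic form bounds the gain over all channels. -/
theorem trace_blochMatrix_mul_le {r : ℕ} {a : Fin r → ℂ} {b : Fin r → Fin 3 → ℂ}
    (h : ∀ ρ, (krausMap a b ρ).trace = ρ.trace) {lam : ℝ}
    (hle : ∀ y, y ⬝ᵥ krausQ a b *ᵥ y ≤ lam * (y ⬝ᵥ y)) {N : QubitMap} (hN : IsQuantumChannel N) :
    (blochMatrix N * blochMatrix (krausMap a b)).trace ≤
      4 * lam + (blochMatrix (krausMap a b)).trace := by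
  obtain ⟨s, c, d, rfl⟩ := hN.1.exists_krausMap
  set t := (blochMatrix (krausMap a b)).trace
  have hterm : ∀ (x₀ : ℝ) (x : Fin 3 → ℝ),
      (blochMatrix (conjMap (pauliUnitary x₀ x)) * blochMatrix (krausMap a b)).trace ≤
        (4 * lam + t) * (x₀ ^ 2 + x ⬝ᵥ x) := fun x₀ x => by
    rw [trace_blochMatrix_pauliUnitary_mul h, ← fourVec_dotProduct_self]
    have := hle (fourVec x₀ x)
    linarith
  have hn := sum_add_trace_krausB hN.2
  -- The weights of the two quaternionic pieces of every Kraus operator of the competing channel sum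
  -- to 1.
  have hsum : ∑ j, (((c j).re ^ 2 + (fun α => (d j α).im) ⬝ᵥ fun α => (d j α).im) +
      ((c j).im ^ 2 + (fun α => -(d j α).re) ⬝ᵥ fun α => -(d j α).re)) = 1 := by
    rw [← hn, Matrix.trace]
    simp only [Matrix.diag_apply, krausB_apply]
    rw [Finset.sum_comm, ← Finset.sum_add_distrib]
    refine Finset.sum_congr rfl fun j _ => ?_
    simp only [dotProduct, Fin.sum_univ_three]
    ring
  rw [krausMap, blochMatrix_sum, Finset.sum_mul, trace_sum, ← mul_one (4 * lam + t), ← hsum,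
    Finset.mul_sum]
  refine Finset.sum_le_sum fun j _ => ?_
  rw [blochMatrix_conjMap_eq_add, add_mul, trace_add, mul_add]
  exact add_le_add (hterm _ _) (hterm _ _)

theorem mainTheorem4 (E : QubitMap) (hE : IsQuantumChannel E) :
    (∀ N : QubitMap, IsQuantumChannel N →
      avgFidelity (N ∘ₗ E) = 1 / 2 * (1 + 1 / 3 * (blochMatrix N * blochMatrix E).trace) ∧
      avgFidelity (E ∘ₗ N) = 1 / 2 * (1 + 1 / 3 * (blochMatrix N * blochMatrix E).trace)) ∧
    (∀ N : QubitMap, IsLeftQuasiInverse E N ↔ IsRightQuasiInverse E N) ∧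
    (∃ (r : ℕ) (a : Fin r → ℂ) (b : Fin r → Fin 3 → ℂ), E = krausMap a b) ∧
    ∀ (r : ℕ) (a : Fin r → ℂ) (b : Fin r → Fin 3 → ℂ), E = krausMap a b →
      (∀ (x₀ : ℝ) (x : Fin 3 → ℝ), x₀ ^ 2 + x ⬝ᵥ x = 1 →
        avgFidelity (conjMap (pauliUnitary x₀ x) ∘ₗ E) - avgFidelity E =
          2 / 3 * (fourVec x₀ x ⬝ᵥ krausQ a b *ᵥ fourVec x₀ x) ∧
        avgFidelity (E ∘ₗ conjMap (pauliUnitary x₀ x)) - avgFidelity E =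
          2 / 3 * (fourVec x₀ x ⬝ᵥ krausQ a b *ᵥ fourVec x₀ x)) ∧
      ∃ lam : ℝ,
        IsGreatest {μ : ℝ | Module.End.HasEigenvalue (Matrix.toLin' (krausQ a b)) μ} lam ∧
        IsGreatest {g : ℝ | ∃ N : QubitMap, IsQuantumChannel N ∧
          g = avgFidelity (N ∘ₗ E) - avgFidelity E} (2 / 3 * max lam 0) ∧
        IsGreatest {g : ℝ | ∃ N : QubitMap, IsQuantumChannel N ∧
          g = avgFidelity (E ∘ₗ N) - avgFidelity E} (2 / 3 * max lam 0) ∧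
        ∀ (x₀ : ℝ) (x : Fin 3 → ℝ), x₀ ^ 2 + x ⬝ᵥ x = 1 →
          krausQ a b *ᵥ fourVec x₀ x = lam • fourVec x₀ x →
          pauliUnitary x₀ x ∈ Matrix.unitaryGroup (Fin 2) ℂ ∧
          IsLeftQuasiInverse E (conjMap (pauliUnitary x₀ x)) ∧
          IsRightQuasiInverse E (conjMap (pauliUnitary x₀ x)) ∧
          ∃ (ϕ : ℝ) (n : Fin 3 → ℝ), n ⬝ᵥ n = 1 ∧ x₀ = Real.cos ϕ ∧ x = Real.sin ϕ • n ∧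
            pauliUnitary x₀ x =
              NormedSpace.exp ((Complex.I * (ϕ : ℂ)) • dotPauli fun α => (n α : ℂ)) := by
  have hL : ∀ N, IsQuantumChannel N → avgFidelity (N ∘ₗ E) =
      1 / 2 + 1 / 6 * (blochMatrix N * blochMatrix E).trace := fun N hN => avgFidelity_comp hN hE
  have hR : ∀ N, IsQuantumChannel N → avgFidelity (E ∘ₗ N) = avgFidelity (N ∘ₗ E) :=
    fun N hN => by rw [hL N hN, avgFidelity_comp hE hN, trace_mul_comm]
  have hLR : ∀ N, IsLeftQuasiInverse E N ↔ IsRightQuasiInverse E N := fun N => by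
    refine and_congr_right fun hN => ?_
    rw [hR N hN]
    refine and_congr_right fun _ => forall₂_congr fun N' hN' => ?_
    rw [hR N' hN']
  refine ⟨fun N hN => ?_, hLR, hE.1.exists_krausMap, ?_⟩
  · rw [hR N hN, hL N hN]
    constructor <;> ring
  rintro r a b rfl
  have hF := avgFidelity_of_trace hE.2
  have hV : ∀ (x₀ : ℝ) (x : Fin 3 → ℝ), x₀ ^ 2 + x ⬝ᵥ x = 1 →
      avgFidelity (conjMap (pauliUnitary x₀ x) ∘ₗ krausMap a b) - avgFidelity (krausMap a b) =
        2 / 3 * (fourVec x₀ x ⬝ᵥ krausQ a b *ᵥ fourVec x₀ x) := fun x₀ x hx => by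
    rw [hL _ (isQuantumChannel_conjMap (pauliUnitary_mem hx)), hF,
      trace_blochMatrix_pauliUnitary_mul hE.2, hx]
    ring
  refine ⟨fun x₀ x hx => ⟨hV x₀ x hx, ?_⟩, ?_⟩
  · rw [hR _ (isQuantumChannel_conjMap (pauliUnitary_mem hx)), hV x₀ x hx]
  obtain ⟨lam, y, hy, hQy, hle⟩ := exists_maximal_eigenvector (krausQ_transpose a b)
  have hy0 : y ≠ 0 := by
    rintro rfl
    simp at hy
  -- The vector (1, 0) is the identity channel, where the form of Q vanishes; hence max(λ, 0) is λ
  -- itself.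
  have hlam : 0 ≤ lam := by
    have h := hle (fourVec 1 0)
    rw [krausQ_quadForm, fourVec_dotProduct_self] at h
    simpa using h
  have hub : ∀ N, IsQuantumChannel N → avgFidelity (N ∘ₗ krausMap a b) -
      avgFidelity (krausMap a b) ≤ 2 / 3 * lam := fun N hN => by
    have := trace_blochMatrix_mul_le hE.2 hle hN
    rw [hL N hN, hF]
    linarith
  have hval : ∀ (x₀ : ℝ) (x : Fin 3 → ℝ), x₀ ^ 2 + x ⬝ᵥ x = 1 →
      krausQ a b *ᵥ fourVec x₀ x = lam • fourVec x₀ x →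
      avgFidelity (conjMap (pauliUnitary x₀ x) ∘ₗ krausMap a b) - avgFidelity (krausMap a b) =
        2 / 3 * lam := fun x₀ x hx h => by
    rw [hV x₀ x hx, h, dotProduct_smul, fourVec_dotProduct_self, hx, smul_eq_mul, mul_one]
  obtain ⟨y₀, z, rfl⟩ := exists_eq_fourVec y
  rw [fourVec_dotProduct_self] at hy
  have hyc := isQuantumChannel_conjMap (pauliUnitary_mem hy)
  refine ⟨lam, isGreatest_hasEigenvalue hy0 hQy hle, ?_, ?_, ?_⟩
  · rw [max_eq_left hlam]
    refine ⟨⟨_, hyc, (hval y₀ z hy hQy).symm⟩, ?_⟩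
    rintro _ ⟨N, hN, rfl⟩
    exact hub N hN
  · rw [max_eq_left hlam]
    refine ⟨⟨_, hyc, by rw [hR _ hyc, hval y₀ z hy hQy]⟩, ?_⟩
    rintro _ ⟨N, hN, rfl⟩
    rw [hR N hN]
    exact hub N hN
  · intro x₀ x hx hQx
    have hxc := isQuantumChannel_conjMap (pauliUnitary_mem hx)
    have hx' := hval x₀ x hx hQx
    have hleft : IsLeftQuasiInverse (krausMap a b) (conjMap (pauliUnitary x₀ x)) := by
      refine ⟨hxc, by linarith, fun N hN => ?_⟩
      have := hub N hN
      linarith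
    refine ⟨pauliUnitary_mem hx, hleft, (hLR _).mp hleft, ?_⟩
    obtain ⟨ϕ, n, hn, rfl, rfl⟩ := exists_cos_sin hx
    exact ⟨ϕ, n, hn, rfl, rfl, pauliUnitary_eq_exp hn⟩

end
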